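/- Let $k$ be a field of characteristic zero and let $\mathfrak{g}$ be a finite-dimensional Lie algebra over $k$. Suppose that $\mathfrak{g}$ admits a Novikov structure, i.e. there is a $k$-bilinear product $\mathfrak{g}\times\mathfrak{g}\to\mathfrak{g}$, $(x,y)\mapsto x\cdot y$, such that for all $x,y,z\in\mathfrak{g}$ $$x\cdot(y\cdot z)-(x\cdot y)\cdot z=y\cdot(x\cdot z)-(y\cdot x)\cdot z,\qquad (x\cdot y)\cdot z=(x\cdot z)\cdot y,\qquad [x,y]=x\cdot y-y\cdot x.$$ Then $\mathfrak{g}$ is solvable. -/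

import Mathlib

/-- A bilinear product `(x, y) ↦ m x y` on a `k`-vector space is left-symmetric if
`x·(y·z) - (x·y)·z = y·(x·z) - (y·x)·z` for all `x, y, z`. -/
def IsLeftSymmetric {k A : Type*} [Field k] [AddCommGroup A] [Module k A]
    (m : A →ₗ[k] A →ₗ[k] A) : Prop :=
  ∀ x y z : A, m x (m y z) - m (m x y) z = m y (m x z) - m (m y x) z

/-- A bilinear product is Novikov if it is left-symmetric and `(x·y)·z = (x·z)·y`
for all `x, y, z`. -/
def IsNovikov {k A : Type*} [Field k] [AddCommGroup A] [Module k A]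
    (m : A →ₗ[k] A →ₗ[k] A) : Prop :=
  IsLeftSymmetric m ∧ ∀ x y z : A, m (m x y) z = m (m x z) y

/-- A Lie algebra `L` over `k` admits a Novikov structure if there is a Novikov product on the
vector space `L` whose commutator is the Lie bracket: `[x, y] = x·y - y·x`. -/
def AdmitsNovikovStructure (k L : Type*) [Field k] [LieRing L] [LieAlgebra k L] : Prop :=
  ∃ m : L →ₗ[k] L →ₗ[k] L, IsNovikov m ∧ ∀ x y : L, ⁅x, y⁆ = m x y - m y x

/-! Right multiplications `R_y = m.flip y` commute, and left-symmetry gives `[L_x, R_y] = R_{xy} -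
R_y R_x`, again in the commutative algebra `S` they generate. A Kleinecke–Shirokov argument makes
these commutators nilpotent, hence also `R_{[x,y]}`. So brackets act on the right through the
nilradical of `S`, a nilpotent ideal, and the derived series dies. -/

open Polynomial in
/-- Inner derivations differentiate polynomials in an element commuting with its derivative. -/
theorem lie_aeval_of_commute {k E : Type*} [CommRing k] [Ring E] [Algebra k E] {l b : E}
    (hb : Commute ⁅l, b⁆ b) (f : k[X]) :
    ⁅l, aeval b f⁆ = aeval b (derivative f) * ⁅l, b⁆ := by
  induction f using Polynomial.induction_on' with
  | add p q hp hq =>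
    have hadd : ∀ x y : E, ⁅l, x + y⁆ = ⁅l, x⁆ + ⁅l, y⁆ := fun x y ↦ by
      simp only [Ring.lie_def]; noncomm_ring
    simp only [map_add, hadd, add_mul, hp, hq]
  | monomial n a =>
    have hpow : ∀ n : ℕ, ⁅l, b ^ n⁆ = (n : E) * b ^ (n - 1) * ⁅l, b⁆ := by
      intro n
      induction n with
      | zero => simp [Ring.lie_def]
      | succ n ih =>
        have h1 : ⁅l, b ^ (n + 1)⁆ = ⁅l, b ^ n⁆ * b + b ^ n * ⁅l, b⁆ := by
          simp only [Ring.lie_def, pow_succ]; noncomm_ring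
        rw [h1, ih, mul_assoc, hb.eq, ← mul_assoc, mul_assoc (n : E)]
        rcases n with _ | n
        · simp
        · rw [Nat.add_sub_cancel, ← pow_succ, Nat.add_sub_cancel, Nat.cast_succ (n + 1)]
          noncomm_ring
    have h2 : ∀ x : E, ⁅l, algebraMap k E a * x⁆ = algebraMap k E a * ⁅l, x⁆ := by
      intro x
      rw [Ring.lie_def, Ring.lie_def, mul_sub, ← mul_assoc, ← Algebra.commutes a l]
      simp only [mul_assoc]
    simp only [derivative_monomial, aeval_monomial, map_mul, map_natCast]
    rw [h2, hpow]
    simp only [mul_assoc]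

open Polynomial in
/-- A variant of the Kleinecke–Shirokov theorem for algebraic elements. -/
theorem isNilpotent_lie_of_commute {k E : Type*} [Field k] [CharZero k] [Ring E] [Algebra k E]
    {l b : E} (hint : IsIntegral k b) (hb : Commute ⁅l, b⁆ b) (hd : Commute ⁅l, ⁅l, b⁆⁆ ⁅l, b⁆) :
    IsNilpotent ⁅l, b⁆ := by
  set d := ⁅l, b⁆
  -- Bracketing `f(b) d^m = 0` with `l`, then multiplying by `d^m`, gives `f'(b) d^(2m+1) = 0`. In
  -- characteristic zero this descends to a nonzero constant.
  suffices H : ∀ (n : ℕ) (f : k[X]) (m : ℕ), f.natDegree = n → f ≠ 0 → aeval b f * d ^ m = 0 →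
      IsNilpotent d from
    H _ (minpoly k b) 0 rfl (minpoly.ne_zero hint) (by simp)
  intro n
  induction n with
  | zero =>
    intro f m hf hf0 h
    rw [eq_C_of_natDegree_eq_zero hf, aeval_C, ← Algebra.smul_def] at h
    have h0 : f.coeff 0 ≠ 0 := fun h0 ↦ hf0 (by rw [eq_C_of_natDegree_eq_zero hf, h0, C_0])
    exact ⟨m, (smul_eq_zero_iff_right h0).mp h⟩
  | succ n ih =>
    intro f m hf hf0 h
    have hdeg : (derivative f).natDegree = n := by rw [natDegree_derivative, hf]; rfl
    have hf' : derivative f ≠ 0 := by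
      intro h0
      have := derivative_eq_zero.mp h0
      omega
    refine ih (derivative f) (1 + m + m) hdeg hf' ?_
    have hpow : Commute ⁅l, d ^ m⁆ (d ^ m) := by
      have hX := lie_aeval_of_commute (k := k) hd (X ^ m)
      simp only [map_pow, aeval_X, derivative_X_pow, map_mul, map_natCast] at hX
      rw [hX]
      exact (((Nat.cast_commute m d).mul_left ((Commute.refl d).pow_left _)).mul_left hd).pow_right m
    have h1 : ⁅l, aeval b f⁆ * d ^ m + aeval b f * ⁅l, d ^ m⁆ = 0 := by
      have : ⁅l, aeval b f * d ^ m⁆ = ⁅l, aeval b f⁆ * d ^ m + aeval b f * ⁅l, d ^ m⁆ := by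
        simp only [Ring.lie_def]; noncomm_ring
      rw [← this, h, Ring.lie_def, mul_zero, zero_mul, sub_zero]
    have h2 : aeval b f * ⁅l, d ^ m⁆ * d ^ m = 0 := by
      rw [mul_assoc, hpow.eq, ← mul_assoc, h, zero_mul]
    have h3 := congrArg (· * d ^ m) h1
    simp only [add_mul, h2, add_zero, zero_mul] at h3
    rw [lie_aeval_of_commute hb] at h3
    rw [pow_add, pow_add, pow_one]
    simpa only [mul_assoc] using h3

section Novikov

variable {k A : Type*} [Field k] [AddCommGroup A] [Module k A] {m : A →ₗ[k] A →ₗ[k] A}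

theorem IsNovikov.commute_flip (h : IsNovikov m) (x y : A) :
    Commute (m.flip x) (m.flip y) :=
  LinearMap.ext fun z ↦ by simpa using h.2 z y x

theorem IsNovikov.lie_flip (h : IsNovikov m) (x y : A) :
    ⁅m x, m.flip y⁆ = m.flip (m x y) - m.flip y * m.flip x :=
  LinearMap.ext fun z ↦ by
    have := h.1 x z y
    simp only [Ring.lie_def, LinearMap.sub_apply, Module.End.mul_apply, LinearMap.flip_apply]
    rw [sub_eq_sub_iff_add_eq_add] at this ⊢
    rw [add_comm, add_comm (m (m z x) y), this]

theorem IsNovikov.isNilpotent_lie_flip [CharZero k] [FiniteDimensional k A] (h : IsNovikov m)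
    (x y : A) : IsNilpotent ⁅m x, m.flip y⁆ := by
  have hc : ∀ z, Commute ⁅m x, m.flip y⁆ (m.flip z) := fun z ↦ by
    rw [h.lie_flip]
    exact (h.commute_flip _ _).sub_left ((h.commute_flip _ _).mul_left (h.commute_flip _ _))
  refine isNilpotent_lie_of_commute (k := k) (Algebra.IsIntegral.isIntegral _) (hc y) ?_
  have hl : ⁅m x, ⁅m x, m.flip y⁆⁆ = ⁅m x, m.flip (m x y)⁆ -
      (⁅m x, m.flip y⁆ * m.flip x + m.flip y * ⁅m x, m.flip x⁆) := by
    conv_lhs => rw [h.lie_flip x y]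
    simp only [Ring.lie_def]; noncomm_ring
  rw [hl, h.lie_flip x (m x y), h.lie_flip x x]
  refine Commute.sub_left (Commute.sub_left ?_ (Commute.mul_left ?_ ?_))
    (Commute.add_left (Commute.mul_left (Commute.refl _) ?_)
      (Commute.mul_left ?_ (Commute.sub_left ?_ (Commute.mul_left ?_ ?_)))) <;>
  exact (hc _).symm

/-- In `[L_x, R_y] - [L_y, R_x]` the quadratic terms cancel, and the two nilpotents commute. -/
theorem IsNovikov.isNilpotent_flip_sub [CharZero k] [FiniteDimensional k A] (h : IsNovikov m)
    (x y : A) : IsNilpotent (m.flip (m x y - m y x)) := by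
  have hs : m.flip (m x y - m y x) = ⁅m x, m.flip y⁆ - ⁅m y, m.flip x⁆ := by
    rw [h.lie_flip, h.lie_flip, map_sub, (h.commute_flip x y).eq]
    abel
  rw [hs]
  refine Commute.isNilpotent_sub ?_ (h.isNilpotent_lie_flip x y) (h.isNilpotent_lie_flip y x)
  have hc := h.commute_flip
  rw [h.lie_flip, h.lie_flip]
  exact ((hc _ _).sub_right ((hc _ _).mul_right (hc _ _))).sub_left
    (((hc _ _).sub_right ((hc _ _).mul_right (hc _ _))).mul_left
      ((hc _ _).sub_right ((hc _ _).mul_right (hc _ _))))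

end Novikov

open scoped IsMulCommutative in
theorem mainTheorem1 (k : Type*) [Field k] [CharZero k]
    (L : Type*) [LieRing L] [LieAlgebra k L] [FiniteDimensional k L]
    (h : AdmitsNovikovStructure k L) : LieAlgebra.IsSolvable L := by
  obtain ⟨m, hm, hbr⟩ := h
  let S := Algebra.adjoin k (Set.range m.flip)
  have : IsMulCommutative S := Algebra.isMulCommutative_adjoin k (by
    rintro _ ⟨x, rfl⟩ _ ⟨y, rfl⟩
    exact hm.commute_flip x y)
  have : IsNoetherianRing S := isNoetherian_of_tower k inferInstance
  obtain ⟨n, hn⟩ := IsNoetherianRing.isNilpotent_nilradical S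
  let R : L →ₗ[k] S := m.flip.codRestrict (Subalgebra.toSubmodule S)
    fun x ↦ Algebra.subset_adjoin ⟨x, rfl⟩
  let N : Submodule k L := ((nilradical S).restrictScalars k).comap R
  let P : ℕ → Submodule k L := fun i ↦ (nilradical S ^ i • ⊤ : Submodule S L).restrictScalars k
  have hN : ∀ x y, ⁅x, y⁆ ∈ N := fun x y ↦ by
    obtain ⟨r, hr⟩ := hm.isNilpotent_flip_sub x y
    exact mem_nilradical.mpr ⟨r, Subtype.ext (by rw [hbr]; exact hr)⟩
  have hP : ∀ i, ∀ x ∈ P i, ∀ y ∈ N, m x y ∈ P (i + 1) := fun i x hx y hy ↦ by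
    change R y • x ∈ nilradical S ^ (i + 1) • (⊤ : Submodule S L)
    rw [pow_succ', Submodule.mul_smul]
    exact Submodule.smul_mem_smul hy hx
  -- The index shift is needed because only brackets are known to lie in `N`; `P 0` is all of `L`.
  have hder : ∀ i, (LieAlgebra.derivedSeries k L (i + 1)).toSubmodule ≤ N ⊓ P i := by
    intro i
    induction i with
    | zero =>
      rw [LieAlgebra.derivedSeries_def, LieAlgebra.derivedSeriesOfIdeal_succ,
        LieSubmodule.lieIdeal_oper_eq_linear_span', Submodule.span_le]
      rintro _ ⟨x, -, y, -, rfl⟩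
      exact ⟨hN x y, by simp [P]⟩
    | succ i ih =>
      rw [LieAlgebra.derivedSeries_def, LieAlgebra.derivedSeriesOfIdeal_succ,
        LieSubmodule.lieIdeal_oper_eq_linear_span', Submodule.span_le]
      rintro _ ⟨x, hx, y, hy, rfl⟩
      refine ⟨hN x y, ?_⟩
      rw [hbr]
      exact sub_mem (hP i x (ih hx).2 y (ih hy).1) (hP i y (ih hy).2 x (ih hx).1)
  rw [LieAlgebra.isSolvable_iff k]
  refine ⟨n + 1, (LieSubmodule.eq_bot_iff _).mpr fun x hx ↦ ?_⟩
  simpa [P, hn] using (hder n hx).2
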